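/- Let $H$ be a Hilbert space with a fixed orthonormal basis. For $k\in\mathbb N$ let $\mathbb B^{(k)}(H)$ be the set of bounded operators on $H$ whose matrix with respect to this basis has at most $k$ non-zero entries in each row and in each column, and let $\mathbb B_f(H)$ be the operator-norm closure of $\bigcup_{k\in\mathbb N}\mathbb B^{(k)}(H)$. Proposition. Let $H=\bigoplus_{n\ge 1}\mathbb C^n$ (Hilbert space direct sum of complex Euclidean spaces), with the orthonormal basis $e_1,e_2,e_3,\ldots$ obtained by listing the standard bases of $\mathbb C^1,\mathbb C^2,\mathbb C^3,\ldots$ one after the other. Let $p_n$ be the operator on $\mathbb C^n$ whose $n\times n$ matrix has all entries equal to $\frac1n$; it is the orthogonal projection onto the line of constant vectors $(x,\ldots,x)$, $x\in\mathbb C$. Set $p=\bigoplus_{n\ge1}p_n$. Let $a_n\in H$ be the vector whose component in the summand $\mathbb C^n$ is $\left(\frac1{\sqrt n},\ldots,\frac1{\sqrt n}\right)$ and whose other components are $0$, and let $v$ be the isometry of $H$ with $v(e_n)=a_n$ for all $n\ge 1$. Then $p\in\mathbb B_f(H)$. Moreover, $p=vv^*$, while $v\notin\mathbb B_f(H)$.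 -/

import Mathlib

noncomputable section

namespace MatrixFinite

/-! Matrix-finite operators on a Hilbert space with a fixed orthonormal basis. -/

section General

variable {ι H : Type*} [NormedAddCommGroup H] [InnerProductSpace ℂ H]

/-- The matrix `(a_{ij})` of a bounded operator `a` with respect to the orthonormal basis `b`. -/
def opMatrix (b : HilbertBasis ι ℂ H) (a : H →L[ℂ] H) : Matrix ι ι ℂ :=
  fun i j => inner ℂ (b i) (a (b j))

/-- Bounded operators whose matrix has at most `k` nonzero entries in each line (row). -/
def rowFinite (b : HilbertBasis ι ℂ H) (k : ℕ) : Set (H →L[ℂ] H) :=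
  {a | ∀ i, {j | opMatrix b a i j ≠ 0}.encard ≤ k}

/-- Bounded operators whose matrix has at most `k` nonzero entries in each column. -/
def colFinite (b : HilbertBasis ι ℂ H) (k : ℕ) : Set (H →L[ℂ] H) :=
  {a | ∀ j, {i | opMatrix b a i j ≠ 0}.encard ≤ k}

/-- Bounded operators whose matrix has at most `k` nonzero entries in each line and column. -/
def finiteOps (b : HilbertBasis ι ℂ H) (k : ℕ) : Set (H →L[ℂ] H) :=
  rowFinite b k ∩ colFinite b k

/-- `𝔹_f(H)`: the closure in operator norm of the union over `k` of the sets `finiteOps b k`. -/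
def Bf (b : HilbertBasis ι ℂ H) : Set (H →L[ℂ] H) :=
  closure (⋃ k : ℕ, finiteOps b k)

end General

/-! The space `⊕_{n ≥ 1} ℂⁿ`. The summand with index `n : ℕ` is `ℂ^(n+1)`; all
positions are counted from `0`. -/

/-- The Hilbert space direct sum `⊕_{n ≥ 1} ℂⁿ`. -/
abbrev BlockSpace : Type := lp (fun n : ℕ => EuclideanSpace ℂ (Fin (n + 1))) 2

/-- The index set of the union of the standard bases of the summands. -/
abbrev BlockIndex : Type := Σ n : ℕ, Fin (n + 1)

/-- The `j`-th standard basis vector of the `n`-th summand. -/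
def blockVec (i : BlockIndex) : BlockSpace :=
  lp.single 2 i.1 (EuclideanSpace.single i.2 1)

theorem inner_blockVec (i : BlockIndex) (x : BlockSpace) :
    inner ℂ (blockVec i) x = x i.1 i.2 := by
  rw [blockVec, lp.inner_single_left, EuclideanSpace.inner_single_left]
  simp

theorem orthonormal_blockVec : Orthonormal ℂ blockVec := by
  rw [orthonormal_iff_ite]
  rintro ⟨n, i⟩ ⟨m, j⟩
  rw [inner_blockVec, blockVec]
  by_cases h : n = m
  · subst h
    simp
  · simp [h]

/-- The orthonormal basis of `⊕ ℂⁿ` made of the standard bases of the summands. -/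
def blockBasis : HilbertBasis BlockIndex ℂ BlockSpace :=
  HilbertBasis.mkOfOrthogonalEqBot orthonormal_blockVec (by
    rw [Submodule.eq_bot_iff]
    intro x hx
    rw [Submodule.mem_orthogonal] at hx
    ext n j
    have := hx (blockVec ⟨n, j⟩) (Submodule.subset_span ⟨_, rfl⟩)
    rw [inner_blockVec] at this
    simpa using this)

theorem blockBasis_apply (i : BlockIndex) : blockBasis i = blockVec i := by
  simp [blockBasis]

/-- The matrix all of whose entries are `1 / size`, as an operator on the `n`-th summand. -/
def blockProj (n : ℕ) :
    EuclideanSpace ℂ (Fin (n + 1)) →L[ℂ] EuclideanSpace ℂ (Fin (n + 1)) :=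
  Matrix.toEuclideanCLM (n := Fin (n + 1)) (𝕜 := ℂ)
    (Matrix.of fun _ _ => 1 / ((n : ℂ) + 1))

/-- The line of constant vectors in the `n`-th summand. -/
def constLine (n : ℕ) : Submodule ℂ (EuclideanSpace ℂ (Fin (n + 1))) :=
  Submodule.span ℂ {WithLp.toLp 2 (fun _ => (1 : ℂ))}

instance (n : ℕ) : (constLine n).HasOrthogonalProjection := by
  unfold constLine; infer_instance

theorem blockProj_eq (n : ℕ) : blockProj n = (constLine n).starProjection := by
  ext x i
  have h1 : ‖(WithLp.toLp 2 (fun _ : Fin (n + 1) => (1 : ℂ)) :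
      EuclideanSpace ℂ (Fin (n + 1)))‖ ^ 2 = (n : ℝ) + 1 := by
    simp [EuclideanSpace.norm_sq_eq]
  have h2 : (constLine n).starProjection x =
      (inner ℂ (WithLp.toLp 2 (fun _ => (1 : ℂ))) x / ((n : ℂ) + 1)) •
        (WithLp.toLp 2 (fun _ => (1 : ℂ)) : EuclideanSpace ℂ (Fin (n + 1))) := by
    have := Submodule.starProjection_singleton (𝕜 := ℂ)
      (v := (WithLp.toLp 2 (fun _ => (1 : ℂ)) : EuclideanSpace ℂ (Fin (n + 1)))) x
    unfold constLine
    rw [this]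
    rw [h1]
    push_cast
    rfl
  rw [h2]
  rw [blockProj, Matrix.ofLp_toEuclideanCLM]
  simp only [Matrix.mulVec, dotProduct, Matrix.of_apply, ← Finset.mul_sum, PiLp.inner_apply,
    PiLp.smul_apply, smul_eq_mul, RCLike.inner_apply, map_one, mul_one]
  ring

theorem norm_blockProj_le (n : ℕ) : ‖blockProj n‖ ≤ 1 := by
  rw [blockProj_eq]
  exact Submodule.starProjection_norm_le _

/-- The operator `p = ⊕ pₙ`, which acts as `blockProj n` on the `n`-th summand. -/
def sumProj : BlockSpace →L[ℂ] BlockSpace :=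
  lp.mapCLM 2 blockProj zero_le_one norm_blockProj_le

/-- The vector `a_{n+1}`: all coordinates in the `n`-th summand are `1/√(n+1)`, all other
coordinates are `0`. -/
def constVec (n : ℕ) : BlockSpace :=
  lp.single 2 n (WithLp.toLp 2 (fun _ => ((1 / √((n : ℝ) + 1) : ℝ) : ℂ)))

/-- The position, counted from `0`, of a basis vector when the bases of `ℂ¹, ℂ², ℂ³, …` are listed
one after the other. -/
def position (i : BlockIndex) : ℕ := (∑ m ∈ Finset.range i.1, (m + 1)) + (i.2 : ℕ)

theorem position_bijective : Function.Bijective position := by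
  constructor
  · have key : ∀ i j : BlockIndex, i.1 < j.1 → position i < position j := by
      rintro ⟨n, i⟩ ⟨m, j⟩ h
      have h1 : ∑ k ∈ Finset.range (n + 1), (k + 1) ≤ ∑ k ∈ Finset.range m, (k + 1) :=
        Finset.sum_le_sum_of_subset (Finset.range_subset_range.2 h)
      rw [Finset.sum_range_succ] at h1
      have := i.2
      simp only [position]
      omega
    intro i j h
    rcases lt_trichotomy i.1 j.1 with hl | he | hl
    · exact absurd h (key i j hl).ne
    · obtain ⟨n, i⟩ := i
      obtain ⟨m, j⟩ := j
      obtain rfl : n = m := he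
      simp only [position] at h
      obtain rfl : i = j := Fin.ext (by omega)
      rfl
    · exact absurd h (key j i hl).ne'
  · intro k
    induction k with
    | zero => exact ⟨⟨0, 0⟩, by simp [position]⟩
    | succ k ih =>
      obtain ⟨⟨n, i⟩, rfl⟩ := ih
      by_cases h : (i : ℕ) < n
      · exact ⟨⟨n, ⟨i + 1, by omega⟩⟩, by simp only [position]; omega⟩
      · refine ⟨⟨n + 1, 0⟩, ?_⟩
        have := i.2
        simp only [position, Finset.sum_range_succ, Fin.val_zero]
        omega

theorem orthonormal_constVec : Orthonormal ℂ constVec := by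
  rw [orthonormal_iff_ite]
  intro n m
  rw [constVec, lp.inner_single_left, constVec]
  by_cases h : n = m
  · subst h
    have h0 : (0 : ℝ) ≤ (n : ℝ) + 1 := by positivity
    have h1 : ((√((n : ℝ) + 1) : ℝ) : ℂ) * (√((n : ℝ) + 1) : ℝ) = (n : ℂ) + 1 := by
      rw [← Complex.ofReal_mul, Real.mul_self_sqrt h0]; push_cast; rfl
    have h2 : ((n : ℂ) + 1) ≠ 0 := by exact_mod_cast Nat.succ_ne_zero n
    rw [lp.single_apply_self]
    simp only [PiLp.inner_apply, RCLike.inner_apply, Complex.conj_ofReal, Finset.sum_const,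
      Finset.card_univ, Fintype.card_fin, nsmul_eq_mul, if_true]
    push_cast
    rw [one_div, ← mul_inv, h1, mul_inv_cancel₀ h2]
  · rw [lp.single_apply_ne _ _ _ h]
    simp [h]

/-- The family indexed by the basis that assigns to a basis vector in position `k` the vector
`constVec k`. -/
theorem orthonormal_target : Orthonormal ℂ (fun i : BlockIndex => constVec (position i)) :=
  orthonormal_constVec.comp position position_bijective.injective

/-- The isometry `v` that sends the basis vector in position `k` to `constVec k`. -/
def isom : BlockSpace →ₗᵢ[ℂ] BlockSpace :=
  (orthonormal_target.orthogonalFamily.linearIsometry).comp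
    blockBasis.repr.toLinearIsometry

/-- The isometry `v` as a bounded operator. -/
def isomOp : BlockSpace →L[ℂ] BlockSpace := isom.toContinuousLinearMap

theorem isomOp_apply (i : BlockIndex) : isomOp (blockBasis i) = constVec (position i) := by
  classical
  simp [isomOp, isom, HilbertBasis.repr_self]

end MatrixFinite

end

open MatrixFinite

/-!
The substance of the statement is that `p` is a norm limit of operators with boundedly many nonzero
entries per row and column. Averaging over `K` permutations of a set with `N` elements has at most
`K` nonzero entries in each row and column, and it is close to the projection onto constants as soon
as it strongly contracts the functions of mean zero. So a family of expanders is needed, and the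
one used here is of Margulis type: the set is `(ℤ/m)²`, the permutations are the identity, the two
unit translations and the two elementary shears.

The spectral gap, `spectral_gap`, is independent of `m`. Let `f` have mean zero and be almost
invariant. Its Fourier transform vanishes at `0`. Almost invariance under translations concentrates
the transform on frequencies of size less than `m / 4` (`sum_fst_far_le`, `sum_snd_far_le`), and
almost invariance under shears makes it almost invariant under the dual shears. On small frequencies
those act as on `ℤ²`, where they play ping-pong: two of them map the first and third quadrants into
disjoint parts of themselves, and their inverses do the same with the other quadrants
(`posCone_pingPong`, `negCone_pingPong`). Hence neither pair of quadrants carries much mass.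

Composing the permutations makes the contraction as strong as desired (`Contracts.exists_pow`). A
block of arbitrary size `n` is reached by choosing `m` with `n ≤ m² ≤ 4n`, restricting the matrix to
`n` of the `m²` positions and rescaling by `m² / n ≤ 4`, which turns the projection onto constants
in dimension `m²` into the one in dimension `n` (`exists_sparse_approx_blockProj`). The direct sum
of these matrices approximates `p`.

The identity `p = v v*` is checked on basis vectors. That `v` is not such a limit holds because its
columns are unit vectors spread evenly over arbitrarily many entries.
-/

open MatrixFinite

namespace MatrixFinite

/-! ### The Fourier transform on `(ℤ/m)²` -/

section Torus

variable {m : ℕ} [NeZero m]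

/-- The unnormalised Fourier transform on `(ℤ/m)²`, with the sign convention
`f̂ ξ = ∑ z, f z * exp (2πi (ξ₁ z₁ + ξ₂ z₂) / m)`. -/
noncomputable def torusFourier (f : ZMod m × ZMod m → ℂ) (ξ : ZMod m × ZMod m) : ℂ :=
  ∑ z, f z * ZMod.stdAddChar (ξ.1 * z.1 + ξ.2 * z.2)

theorem torusFourier_sub (f g : ZMod m × ZMod m → ℂ) (ξ : ZMod m × ZMod m) :
    torusFourier (fun z => f z - g z) ξ = torusFourier f ξ - torusFourier g ξ := by
  simp [torusFourier, sub_mul, Finset.sum_sub_distrib]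

/-- Orthogonality of the characters of `(ℤ/m)²`. -/
theorem sum_stdAddChar_torus (z w : ZMod m × ZMod m) :
    ∑ ξ : ZMod m × ZMod m, (ZMod.stdAddChar (ξ.1 * z.1 + ξ.2 * z.2) : ℂ) *
      (starRingEnd ℂ) (ZMod.stdAddChar (ξ.1 * w.1 + ξ.2 * w.2)) =
      if z = w then (m : ℂ) ^ 2 else 0 := by
  have h : ∀ ξ : ZMod m × ZMod m, (ZMod.stdAddChar (ξ.1 * z.1 + ξ.2 * z.2) : ℂ) *
      (starRingEnd ℂ) (ZMod.stdAddChar (ξ.1 * w.1 + ξ.2 * w.2)) =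
      ZMod.stdAddChar (ξ.1 * (z.1 - w.1)) * ZMod.stdAddChar (ξ.2 * (z.2 - w.2)) := by
    intro ξ
    rw [← AddChar.map_neg_eq_conj, ← AddChar.map_add_eq_mul, ← AddChar.map_add_eq_mul]
    congr 1
    ring
  simp_rw [h]
  rw [Fintype.sum_prod_type]
  simp_rw [← Finset.mul_sum, AddChar.sum_mulShift _ (ZMod.isPrimitive_stdAddChar m),
    ← Finset.sum_mul, AddChar.sum_mulShift _ (ZMod.isPrimitive_stdAddChar m), sub_eq_zero,
    ZMod.card, Prod.ext_iff]
  by_cases h1 : z.1 = w.1 <;> by_cases h2 : z.2 = w.2 <;> simp [h1, h2, sq]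

/-- Parseval's identity. -/
theorem sum_norm_sq_torusFourier (f : ZMod m × ZMod m → ℂ) :
    ∑ ξ, ‖torusFourier f ξ‖ ^ 2 = (m : ℝ) ^ 2 * ∑ z, ‖f z‖ ^ 2 := by
  have h : ∑ ξ, torusFourier f ξ * (starRingEnd ℂ) (torusFourier f ξ) =
      (m : ℂ) ^ 2 * ∑ z, f z * (starRingEnd ℂ) (f z) := by
    simp_rw [torusFourier, map_sum, map_mul, Finset.sum_mul_sum]
    rw [Finset.sum_comm, Finset.mul_sum]
    refine Finset.sum_congr rfl fun z _ => ?_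
    rw [Finset.sum_comm]
    have : ∀ w, ∑ ξ : ZMod m × ZMod m, f z * (ZMod.stdAddChar (ξ.1 * z.1 + ξ.2 * z.2) : ℂ) *
        ((starRingEnd ℂ) (f w) *
          (starRingEnd ℂ) (ZMod.stdAddChar (ξ.1 * w.1 + ξ.2 * w.2))) =
        f z * (starRingEnd ℂ) (f w) * (if z = w then (m : ℂ) ^ 2 else 0) := by
      intro w
      rw [← sum_stdAddChar_torus, Finset.mul_sum]
      exact Finset.sum_congr rfl fun ξ _ => by ring
    simp_rw [this]
    simp
    ring
  simp_rw [Complex.mul_conj'] at h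
  exact_mod_cast h

/-! ### Generators of an expander on `(ℤ/m)²` -/

/-- The shear `(x, y) ↦ (x + y, y)` of `(ℤ/m)²`. -/
def shearFst (m : ℕ) : Equiv.Perm (ZMod m × ZMod m) where
  toFun z := (z.1 + z.2, z.2)
  invFun z := (z.1 - z.2, z.2)
  left_inv z := by simp
  right_inv z := by simp

/-- The shear `(x, y) ↦ (x, x + y)` of `(ℤ/m)²`. -/
def shearSnd (m : ℕ) : Equiv.Perm (ZMod m × ZMod m) where
  toFun z := (z.1, z.1 + z.2)
  invFun z := (z.1, z.2 - z.1)
  left_inv z := by simp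
  right_inv z := by simp

theorem torusFourier_comp_shearFst (f : ZMod m × ZMod m → ℂ) (ξ : ZMod m × ZMod m) :
    torusFourier (fun z => f (shearFst m z)) ξ = torusFourier f ((shearSnd m).symm ξ) := by
  rw [torusFourier, torusFourier]
  refine Eq.trans ?_ (Equiv.sum_comp (shearFst m) _)
  refine Finset.sum_congr rfl fun z _ => ?_
  congr 2
  simp only [shearFst, shearSnd, Equiv.coe_fn_mk, Equiv.coe_fn_symm_mk]
  ring

theorem torusFourier_comp_shearSnd (f : ZMod m × ZMod m → ℂ) (ξ : ZMod m × ZMod m) :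
    torusFourier (fun z => f (shearSnd m z)) ξ = torusFourier f ((shearFst m).symm ξ) := by
  rw [torusFourier, torusFourier]
  refine Eq.trans ?_ (Equiv.sum_comp (shearSnd m) _)
  refine Finset.sum_congr rfl fun z _ => ?_
  congr 2
  simp only [shearFst, shearSnd, Equiv.coe_fn_mk, Equiv.coe_fn_symm_mk]
  ring

theorem torusFourier_comp_addRight (f : ZMod m × ZMod m → ℂ) (a ξ : ZMod m × ZMod m) :
    torusFourier (fun z => f (Equiv.addRight a z)) ξ =
      ZMod.stdAddChar (-(ξ.1 * a.1 + ξ.2 * a.2)) * torusFourier f ξ := by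
  rw [torusFourier, torusFourier, Finset.mul_sum]
  refine Eq.trans ?_ (Equiv.sum_comp (Equiv.addRight a) _)
  refine Finset.sum_congr rfl fun z _ => ?_
  rw [mul_left_comm, ← AddChar.map_add_eq_mul]
  congr 2
  simp only [Equiv.coe_addRight, Prod.fst_add, Prod.snd_add]
  ring

/-- Parseval for the displacement of `f` under the first shear; the dual action is by the inverse of
the second shear. -/
theorem sum_norm_sq_shearFst (f : ZMod m × ZMod m → ℂ) :
    ∑ ξ, ‖torusFourier f ((shearSnd m).symm ξ) - torusFourier f ξ‖ ^ 2 =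
      (m : ℝ) ^ 2 * ∑ z, ‖f (shearFst m z) - f z‖ ^ 2 := by
  rw [← sum_norm_sq_torusFourier (fun z => f (shearFst m z) - f z)]
  simp_rw [torusFourier_sub, torusFourier_comp_shearFst]

theorem sum_norm_sq_shearSnd (f : ZMod m × ZMod m → ℂ) :
    ∑ ξ, ‖torusFourier f ((shearFst m).symm ξ) - torusFourier f ξ‖ ^ 2 =
      (m : ℝ) ^ 2 * ∑ z, ‖f (shearSnd m z) - f z‖ ^ 2 := by
  rw [← sum_norm_sq_torusFourier (fun z => f (shearSnd m z) - f z)]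
  simp_rw [torusFourier_sub, torusFourier_comp_shearSnd]

/-- For `x` at distance at least `m / 4` from `0`, the character value `exp (-2πix/m)`, by which a
unit translation multiplies the Fourier transform at that frequency, has nonpositive real part. -/
theorem two_le_norm_sq_stdAddChar_sub_one {x : ZMod m} (hx : (m : ℤ) ≤ 4 * |x.valMinAbs|) :
    2 ≤ ‖(ZMod.stdAddChar (-x) : ℂ) - 1‖ ^ 2 := by
  have hm : (0 : ℝ) < m := by exact_mod_cast Nat.pos_of_ne_zero (NeZero.ne m)
  set a : ℤ := x.valMinAbs with ha
  have h1 : (ZMod.stdAddChar (-x) : ℂ) =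
      Complex.exp (((-(2 * Real.pi * a / m) : ℝ) : ℂ) * Complex.I) := by
    have : -x = ((-a : ℤ) : ZMod m) := by rw [ha, Int.cast_neg, ZMod.coe_valMinAbs]
    rw [this, ZMod.stdAddChar_coe]
    congr 1
    push_cast
    ring
  have h2 : |a| * 2 ≤ m := by
    have := x.valMinAbs_mem_Ioc
    rw [← ha] at this
    have h3 := this.1
    have h4 := this.2
    rcases abs_cases a with h | h <;> omega
  have hx' : (m : ℝ) ≤ 4 * |(a : ℝ)| := by exact_mod_cast hx
  have h2' : |(a : ℝ)| * 2 ≤ m := by exact_mod_cast h2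
  have hcos : Real.cos (2 * Real.pi * a / m) ≤ 0 := by
    rw [← Real.cos_abs]
    have : |2 * Real.pi * a / m| = 2 * Real.pi * |(a : ℝ)| / m := by
      rw [abs_div, abs_mul, abs_of_pos hm, abs_of_pos (by positivity)]
    rw [this]
    have hpi := Real.pi_pos
    apply Real.cos_nonpos_of_pi_div_two_le_of_le
    · rw [div_le_div_iff₀ (by norm_num) hm]
      nlinarith
    · rw [div_le_iff₀ hm]
      nlinarith
  rw [h1, Complex.sq_norm, Complex.normSq_apply]
  simp only [Complex.sub_re, Complex.exp_ofReal_mul_I_re, Complex.one_re, Complex.sub_im,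
    Complex.exp_ofReal_mul_I_im, Complex.one_im, Real.cos_neg, Real.sin_neg]
  nlinarith [Real.sin_sq_add_cos_sq (2 * Real.pi * a / m)]

/-- Almost invariance under the translation by `(1, 0)` confines the Fourier transform to
frequencies with small first coordinate. -/
theorem sum_fst_far_le (f : ZMod m × ZMod m → ℂ) :
    2 * ∑ ξ : ZMod m × ZMod m with (m : ℤ) ≤ 4 * |ξ.1.valMinAbs|, ‖torusFourier f ξ‖ ^ 2 ≤
      (m : ℝ) ^ 2 * ∑ z, ‖f (Equiv.addRight (1, 0) z) - f z‖ ^ 2 := by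
  rw [← sum_norm_sq_torusFourier (fun z => f (Equiv.addRight (1, 0) z) - f z), Finset.mul_sum]
  refine (Finset.sum_le_sum fun ξ hξ => ?_).trans
    (Finset.sum_le_sum_of_subset_of_nonneg (Finset.filter_subset _ _) fun _ _ _ => by positivity)
  have h := two_le_norm_sq_stdAddChar_sub_one (Finset.mem_filter.1 hξ).2
  rw [torusFourier_sub, torusFourier_comp_addRight, ← sub_one_mul, norm_mul, mul_pow]
  simpa using mul_le_mul_of_nonneg_right h (sq_nonneg ‖torusFourier f ξ‖)

theorem sum_snd_far_le (f : ZMod m × ZMod m → ℂ) :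
    2 * ∑ ξ : ZMod m × ZMod m with (m : ℤ) ≤ 4 * |ξ.2.valMinAbs|, ‖torusFourier f ξ‖ ^ 2 ≤
      (m : ℝ) ^ 2 * ∑ z, ‖f (Equiv.addRight (0, 1) z) - f z‖ ^ 2 := by
  rw [← sum_norm_sq_torusFourier (fun z => f (Equiv.addRight (0, 1) z) - f z), Finset.mul_sum]
  refine (Finset.sum_le_sum fun ξ hξ => ?_).trans
    (Finset.sum_le_sum_of_subset_of_nonneg (Finset.filter_subset _ _) fun _ _ _ => by positivity)
  have h := two_le_norm_sq_stdAddChar_sub_one (Finset.mem_filter.1 hξ).2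
  rw [torusFourier_sub, torusFourier_comp_addRight, ← sub_one_mul, norm_mul, mul_pow]
  simpa using mul_le_mul_of_nonneg_right h (sq_nonneg ‖torusFourier f ξ‖)

end Torus

/-! ### The ping-pong estimate -/

/-- If `σ` and `τ` map `A` to disjoint parts of `B` and almost preserve `F`, then the mass of `F`
on `A` is, up to a factor and the displacements of `F`, at most half of its mass on `B`. -/
theorem two_mul_sum_norm_sq_le {V : Type*} [Fintype V] [DecidableEq V] (F : V → ℂ)
    (σ τ : Equiv.Perm V) {A B : Finset V} (hσ : ∀ a ∈ A, σ a ∈ B) (hτ : ∀ a ∈ A, τ a ∈ B)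
    (hd : ∀ a ∈ A, ∀ b ∈ A, σ a ≠ τ b) :
    2 * ∑ a ∈ A, ‖F a‖ ^ 2 ≤ 5 / 4 * ∑ b ∈ B, ‖F b‖ ^ 2 +
      5 * (∑ v, ‖F (σ v) - F v‖ ^ 2 + ∑ v, ‖F (τ v) - F v‖ ^ 2) := by
  have key : ∀ ρ : Equiv.Perm V, ∑ a ∈ A, ‖F a‖ ^ 2 ≤
      5 / 4 * ∑ b ∈ A.map ρ.toEmbedding, ‖F b‖ ^ 2 + 5 * ∑ v, ‖F (ρ v) - F v‖ ^ 2 := by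
    intro ρ
    have h1 : ∑ a ∈ A, ‖F (ρ a) - F a‖ ^ 2 ≤ ∑ v, ‖F (ρ v) - F v‖ ^ 2 :=
      Finset.sum_le_sum_of_subset_of_nonneg (Finset.subset_univ _) fun _ _ _ => by positivity
    have h2 : ∑ a ∈ A, ‖F a‖ ^ 2 ≤
        5 / 4 * ∑ a ∈ A, ‖F (ρ a)‖ ^ 2 + 5 * ∑ a ∈ A, ‖F (ρ a) - F a‖ ^ 2 := by
      rw [Finset.mul_sum, Finset.mul_sum, ← Finset.sum_add_distrib]
      refine Finset.sum_le_sum fun a _ => ?_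
      have h3 : ‖F a‖ ≤ ‖F (ρ a)‖ + ‖F (ρ a) - F a‖ := by
        simpa using norm_sub_le (F (ρ a)) (F (ρ a) - F a)
      have h4 := norm_nonneg (F a)
      -- `(x + y)² ≤ 5/4 x² + 5 y²`; the factor must be below `2` for the ping-pong to gain.
      nlinarith [sq_nonneg (‖F (ρ a)‖ - 4 * ‖F (ρ a) - F a‖)]
    rw [Finset.sum_map]
    simp only [Equiv.coe_toEmbedding]
    linarith
  have h1 := key σ
  have h2 := key τ
  have h3 : ∑ b ∈ A.map σ.toEmbedding, ‖F b‖ ^ 2 + ∑ b ∈ A.map τ.toEmbedding, ‖F b‖ ^ 2 ≤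
      ∑ b ∈ B, ‖F b‖ ^ 2 := by
    rw [← Finset.sum_union]
    · refine Finset.sum_le_sum_of_subset_of_nonneg ?_ fun _ _ _ => by positivity
      intro b hb
      simp only [Finset.mem_union, Finset.mem_map, Equiv.coe_toEmbedding] at hb
      rcases hb with ⟨a, ha, rfl⟩ | ⟨a, ha, rfl⟩
      exacts [hσ a ha, hτ a ha]
    · rw [Finset.disjoint_left]
      intro b hb hb'
      simp only [Finset.mem_map, Equiv.coe_toEmbedding] at hb hb'
      obtain ⟨a, ha, rfl⟩ := hb
      obtain ⟨c, hc, hac⟩ := hb'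
      exact hd a ha c hc hac.symm
  linarith

section Gap

variable {m : ℕ} [NeZero m]

/-- The frequencies both of whose coordinates are at distance less than `m / 4` from `0`. -/
def freqBox (m : ℕ) [NeZero m] : Finset (ZMod m × ZMod m) :=
  {ξ | 4 * |ξ.1.valMinAbs| < m ∧ 4 * |ξ.2.valMinAbs| < m}

/-- The frequencies in the first and third quadrants: the half-open cone that contains the
horizontal axis, without the origin. -/
def posCone (m : ℕ) [NeZero m] : Finset (ZMod m × ZMod m) :=
  {ξ | (0 < ξ.1.valMinAbs ∧ 0 ≤ ξ.2.valMinAbs) ∨ (ξ.1.valMinAbs < 0 ∧ ξ.2.valMinAbs ≤ 0)}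

/-- The frequencies in the second and fourth quadrants: the half-open cone that contains the
vertical axis, without the origin. -/
def negCone (m : ℕ) [NeZero m] : Finset (ZMod m × ZMod m) :=
  {ξ | (ξ.1.valMinAbs ≤ 0 ∧ 0 < ξ.2.valMinAbs) ∨ (0 ≤ ξ.1.valMinAbs ∧ ξ.2.valMinAbs < 0)}

theorem valMinAbs_add_of_small {x y : ZMod m} (hx : 4 * |x.valMinAbs| < m)
    (hy : 4 * |y.valMinAbs| < m) : (x + y).valMinAbs = x.valMinAbs + y.valMinAbs := by
  rw [ZMod.valMinAbs_spec]
  refine ⟨by push_cast; simp, ?_⟩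
  rw [Set.mem_Ioc]
  rcases abs_cases x.valMinAbs with h | h <;> rcases abs_cases y.valMinAbs with h' | h' <;> omega

theorem valMinAbs_sub_of_small {x y : ZMod m} (hx : 4 * |x.valMinAbs| < m)
    (hy : 4 * |y.valMinAbs| < m) : (x - y).valMinAbs = x.valMinAbs - y.valMinAbs := by
  rw [ZMod.valMinAbs_spec]
  refine ⟨by push_cast; simp, ?_⟩
  rw [Set.mem_Ioc]
  rcases abs_cases x.valMinAbs with h | h <;> rcases abs_cases y.valMinAbs with h' | h' <;> omega

/-- Inside the box nothing wraps around modulo `m`, so the shears act as on `ℤ²`: they map the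
first and third quadrants to the disjoint sectors `|y| < |x|` and `|x| ≤ |y|` of themselves. -/
theorem posCone_pingPong (F : ZMod m × ZMod m → ℂ) :
    2 * ∑ ξ ∈ posCone m ∩ freqBox m, ‖F ξ‖ ^ 2 ≤ 5 / 4 * ∑ ξ ∈ posCone m, ‖F ξ‖ ^ 2 +
      5 * (∑ ξ, ‖F (shearFst m ξ) - F ξ‖ ^ 2 + ∑ ξ, ‖F (shearSnd m ξ) - F ξ‖ ^ 2) := by
  apply two_mul_sum_norm_sq_le
  · intro ξ hξ
    simp only [posCone, freqBox, Finset.mem_inter, Finset.mem_filter, Finset.mem_univ,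
      true_and] at hξ
    simp only [posCone, shearFst, Equiv.coe_fn_mk, Finset.mem_filter, Finset.mem_univ, true_and,
      valMinAbs_add_of_small hξ.2.1 hξ.2.2]
    omega
  · intro ξ hξ
    simp only [posCone, freqBox, Finset.mem_inter, Finset.mem_filter, Finset.mem_univ,
      true_and] at hξ
    simp only [posCone, shearSnd, Equiv.coe_fn_mk, Finset.mem_filter, Finset.mem_univ, true_and,
      valMinAbs_add_of_small hξ.2.1 hξ.2.2]
    omega
  · intro ξ hξ η hη h
    simp only [posCone, freqBox, Finset.mem_inter, Finset.mem_filter, Finset.mem_univ,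
      true_and] at hξ hη
    simp only [shearFst, shearSnd, Equiv.coe_fn_mk, Prod.mk.injEq] at h
    have h1 := congrArg ZMod.valMinAbs h.1
    have h2 := congrArg ZMod.valMinAbs h.2
    rw [valMinAbs_add_of_small hξ.2.1 hξ.2.2] at h1
    rw [valMinAbs_add_of_small hη.2.1 hη.2.2] at h2
    omega

/-- The counterpart of `posCone_pingPong` for the inverse shears on the other two quadrants. -/
theorem negCone_pingPong (F : ZMod m × ZMod m → ℂ) :
    2 * ∑ ξ ∈ negCone m ∩ freqBox m, ‖F ξ‖ ^ 2 ≤ 5 / 4 * ∑ ξ ∈ negCone m, ‖F ξ‖ ^ 2 +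
      5 * (∑ ξ, ‖F ((shearFst m).symm ξ) - F ξ‖ ^ 2 +
        ∑ ξ, ‖F ((shearSnd m).symm ξ) - F ξ‖ ^ 2) := by
  apply two_mul_sum_norm_sq_le
  · intro ξ hξ
    simp only [negCone, freqBox, Finset.mem_inter, Finset.mem_filter, Finset.mem_univ,
      true_and] at hξ
    simp only [negCone, shearFst, Equiv.coe_fn_symm_mk, Finset.mem_filter, Finset.mem_univ,
      true_and, valMinAbs_sub_of_small hξ.2.1 hξ.2.2]
    omega
  · intro ξ hξ
    simp only [negCone, freqBox, Finset.mem_inter, Finset.mem_filter, Finset.mem_univ,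
      true_and] at hξ
    simp only [negCone, shearSnd, Equiv.coe_fn_symm_mk, Finset.mem_filter, Finset.mem_univ,
      true_and, valMinAbs_sub_of_small hξ.2.2 hξ.2.1]
    omega
  · intro ξ hξ η hη h
    simp only [negCone, freqBox, Finset.mem_inter, Finset.mem_filter, Finset.mem_univ,
      true_and] at hξ hη
    simp only [shearFst, shearSnd, Equiv.coe_fn_symm_mk, Prod.mk.injEq] at h
    have h1 := congrArg ZMod.valMinAbs h.1
    have h2 := congrArg ZMod.valMinAbs h.2
    rw [valMinAbs_sub_of_small hξ.2.1 hξ.2.2] at h1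
    rw [valMinAbs_sub_of_small hη.2.2 hη.2.1] at h2
    omega

theorem sum_norm_sq_symm_sub {V : Type*} [Fintype V] (F : V → ℂ) (σ : Equiv.Perm V) :
    ∑ v, ‖F (σ.symm v) - F v‖ ^ 2 = ∑ v, ‖F (σ v) - F v‖ ^ 2 := by
  rw [← Equiv.sum_comp σ]
  exact Finset.sum_congr rfl fun v _ => by rw [Equiv.symm_apply_apply, norm_sub_rev]

/-- The spectral gap: a function on `(ℤ/m)²` of mean zero is displaced, by a proportion of its norm
that does not depend on `m`, by a unit translation or by a shear. -/
theorem spectral_gap (f : ZMod m × ZMod m → ℂ) (hf : ∑ z, f z = 0) :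
    ∑ z, ‖f z‖ ^ 2 ≤ 14 * (∑ z, ‖f (Equiv.addRight (1, 0) z) - f z‖ ^ 2 +
      ∑ z, ‖f (Equiv.addRight (0, 1) z) - f z‖ ^ 2 + ∑ z, ‖f (shearFst m z) - f z‖ ^ 2 +
      ∑ z, ‖f (shearSnd m z) - f z‖ ^ 2) := by
  have hm : (0 : ℝ) < m := by exact_mod_cast Nat.pos_of_ne_zero (NeZero.ne m)
  set F := torusFourier f with hF
  have hF0 : F 0 = 0 := by simpa [hF, torusFourier] using hf
  set G : Finset (ZMod m × ZMod m) → ℝ := fun A => ∑ ξ ∈ A, ‖F ξ‖ ^ 2 with hG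
  have hmono : ∀ {A B : Finset (ZMod m × ZMod m)}, A ⊆ B → G A ≤ G B := fun h =>
    Finset.sum_le_sum_of_subset_of_nonneg h fun _ _ _ => by positivity
  have hunion : ∀ A B : Finset (ZMod m × ZMod m), G (A ∪ B) ≤ G A + G B := fun A B => by
    simp only [hG]
    rw [← Finset.sum_union_inter]
    have : 0 ≤ ∑ ξ ∈ A ∩ B, ‖F ξ‖ ^ 2 := by positivity
    linarith
  have hsplit : ∀ A B : Finset (ZMod m × ZMod m), G A ≤ G (A ∩ B) + G Bᶜ := fun A B =>
    (hmono (fun x hx => by by_cases h : x ∈ B <;> simp [h, hx])).trans (hunion _ _)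
  have hout : 2 * G (freqBox m)ᶜ ≤
      (m : ℝ) ^ 2 * ∑ z, ‖f (Equiv.addRight (1, 0) z) - f z‖ ^ 2 +
      (m : ℝ) ^ 2 * ∑ z, ‖f (Equiv.addRight (0, 1) z) - f z‖ ^ 2 := by
    have h1 := sum_fst_far_le f
    have h2 := sum_snd_far_le f
    have h3 : G (freqBox m)ᶜ ≤ _ := (hmono (B := Finset.univ.filter
      (fun ξ : ZMod m × ZMod m => (m : ℤ) ≤ 4 * |ξ.1.valMinAbs|) ∪ Finset.univ.filter
      (fun ξ : ZMod m × ZMod m => (m : ℤ) ≤ 4 * |ξ.2.valMinAbs|)) (fun ξ hξ => by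
        simp only [freqBox, Finset.mem_compl, Finset.mem_filter, Finset.mem_univ, true_and,
          Finset.mem_union] at hξ ⊢
        omega)).trans (hunion _ _)
    simp only [hG] at h3 ⊢
    linarith
  have hall : ∑ ξ, ‖F ξ‖ ^ 2 ≤ G (posCone m) + G (negCone m) := by
    have h1 : G (posCone m ∪ negCone m) = ∑ ξ, ‖F ξ‖ ^ 2 := by
      refine Finset.sum_subset (Finset.subset_univ _) fun ξ _ hξ => ?_
      have h0 : ξ = 0 := by
        simp only [posCone, negCone, Finset.mem_union, Finset.mem_filter, Finset.mem_univ,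
          true_and] at hξ
        refine Prod.ext ?_ ?_
        · exact (ZMod.valMinAbs_eq_zero _).1 (by omega)
        · exact (ZMod.valMinAbs_eq_zero _).1 (by omega)
      rw [h0, hF0]
      simp
    rw [← h1]
    exact hunion _ _
  have hpos := posCone_pingPong F
  have hneg := negCone_pingPong F
  have hposs := hsplit (posCone m) (freqBox m)
  have hnegs := hsplit (negCone m) (freqBox m)
  have hS := sum_norm_sq_shearFst f
  have hT := sum_norm_sq_shearSnd f
  rw [← hF] at hS hT
  rw [← sum_norm_sq_symm_sub F (shearFst m), ← sum_norm_sq_symm_sub F (shearSnd m)] at hpos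
  rw [hS, hT] at hpos hneg
  have hP := sum_norm_sq_torusFourier f
  rw [← hF] at hP
  rw [hP] at hall
  have h1 : 0 ≤ ∑ z, ‖f (Equiv.addRight (1, 0) z) - f z‖ ^ 2 := by positivity
  have h2 : 0 ≤ ∑ z, ‖f (Equiv.addRight (0, 1) z) - f z‖ ^ 2 := by positivity
  have h3 : 0 ≤ ∑ z, ‖f (shearFst m z) - f z‖ ^ 2 := by positivity
  have h4 : 0 ≤ ∑ z, ‖f (shearSnd m z) - f z‖ ^ 2 := by positivity
  -- With `D` the total displacement and `E` the mass outside the box, the two ping-pong estimates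
  -- bound the mass in the box by `10 / 3 * E + 40 / 3 * D`, and `E` involves translations only.
  refine le_of_mul_le_mul_left ?_ (pow_pos hm 2)
  have h1' := mul_nonneg (pow_pos hm 2).le h1
  have h2' := mul_nonneg (pow_pos hm 2).le h2
  have h3' := mul_nonneg (pow_pos hm 2).le h3
  have h4' := mul_nonneg (pow_pos hm 2).le h4
  simp only [hG] at hout hall hpos hneg hposs hnegs
  nlinarith

end Gap

/-! ### Averages of permutations -/

section Averages

variable {V : Type*} [Fintype V]

/-- Quantitative strict convexity of the squared norm: an average is shorter than its terms, in
proportion to the distances of the terms from a fixed one of them. -/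
theorem norm_sq_sum_le {ι : Type*} [Fintype ι] (a : ι → ℂ) (i₀ : ι) :
    ‖∑ i, a i‖ ^ 2 ≤ Fintype.card ι * ∑ i, ‖a i‖ ^ 2 - (1 / 2) * ∑ i, ‖a i - a i₀‖ ^ 2 := by
  have h1 : ∀ i j, ‖a i - a j‖ ^ 2 =
      ‖a i‖ ^ 2 + ‖a j‖ ^ 2 - 2 * (a i * (starRingEnd ℂ) (a j)).re := by
    intro i j
    rw [Complex.sq_norm, Complex.normSq_sub, Complex.sq_norm, Complex.sq_norm]
  have h2 : ∑ i, ∑ j, (a i * (starRingEnd ℂ) (a j)).re = ‖∑ i, a i‖ ^ 2 := by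
    simp_rw [← Complex.re_sum]
    rw [← Finset.sum_mul_sum, ← map_sum, Complex.mul_conj']
    exact_mod_cast rfl
  have h3 : ∑ i, ∑ j, ‖a i - a j‖ ^ 2 =
      2 * (Fintype.card ι * ∑ i, ‖a i‖ ^ 2) - 2 * ‖∑ i, a i‖ ^ 2 := by
    simp_rw [h1, Finset.sum_sub_distrib, Finset.sum_add_distrib, ← Finset.mul_sum, h2]
    simp only [Finset.sum_const, Finset.card_univ, nsmul_eq_mul, ← Finset.mul_sum]
    ring
  have h4 : ∑ i, ‖a i - a i₀‖ ^ 2 ≤ ∑ i, ∑ j, ‖a i - a j‖ ^ 2 :=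
    Finset.sum_le_sum fun i _ => Finset.single_le_sum (f := fun j => ‖a i - a j‖ ^ 2)
      (fun _ _ => by positivity) (Finset.mem_univ i₀)
  linarith

/-- The average of `f` over the images of a point under a finite family of permutations. -/
noncomputable def permAvg {k : ℕ} (σ : Fin k → Equiv.Perm V) (f : V → ℂ) (v : V) : ℂ :=
  (k : ℂ)⁻¹ * ∑ i, f (σ i v)

/-- A family of permutations contracts by `c` if its averaging operator shrinks the squared
`ℓ²` norm of every function of mean zero by the factor `c`. -/
def Contracts {k : ℕ} (σ : Fin k → Equiv.Perm V) (c : ℝ) : Prop :=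
  ∀ f : V → ℂ, ∑ v, f v = 0 → ∑ v, ‖permAvg σ f v‖ ^ 2 ≤ c * ∑ v, ‖f v‖ ^ 2

/-- With the identity among the permutations, every displacement of `f` shortens its average. -/
theorem sum_norm_sq_permAvg_le {k : ℕ} (σ : Fin k → Equiv.Perm V) {i₀ : Fin k} (h : σ i₀ = 1)
    (f : V → ℂ) :
    ∑ v, ‖permAvg σ f v‖ ^ 2 ≤
      ∑ v, ‖f v‖ ^ 2 - (1 / (2 * (k : ℝ) ^ 2)) * ∑ i, ∑ v, ‖f (σ i v) - f v‖ ^ 2 := by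
  have hk : (0 : ℝ) < k := by exact_mod_cast i₀.pos
  have h1 : ∀ v, ‖permAvg σ f v‖ ^ 2 ≤ ((k : ℝ) ^ 2)⁻¹ *
      (k * ∑ i, ‖f (σ i v)‖ ^ 2 - (1 / 2) * ∑ i, ‖f (σ i v) - f v‖ ^ 2) := by
    intro v
    have := norm_sq_sum_le (fun i => f (σ i v)) i₀
    simp only [h, Equiv.Perm.coe_one, id_eq, Fintype.card_fin] at this
    rw [permAvg, norm_mul, mul_pow, norm_inv, Complex.norm_natCast, inv_pow]
    exact mul_le_mul_of_nonneg_left this (by positivity)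
  refine (Finset.sum_le_sum fun v _ => h1 v).trans (le_of_eq ?_)
  rw [← Finset.mul_sum, Finset.sum_sub_distrib, ← Finset.mul_sum, ← Finset.mul_sum,
    Finset.sum_comm, Finset.sum_comm (f := fun v i => ‖f (σ i v) - f v‖ ^ 2)]
  simp_rw [fun i => Equiv.sum_comp (σ i) (fun v => ‖f v‖ ^ 2)]
  simp only [Finset.sum_const, Finset.card_univ, Fintype.card_fin, nsmul_eq_mul]
  field_simp

/-- A family of five permutations of `(ℤ/m)²`: the identity, the unit translations and the
shears. -/
def torusGen (m : ℕ) : Fin 5 → Equiv.Perm (ZMod m × ZMod m) :=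
  ![1, Equiv.addRight (1, 0), Equiv.addRight (0, 1), shearFst m, shearSnd m]

/-- The constant is `1 - 1 / (2 * 5 ^ 2 * 14)`: five permutations and the gap `1 / 14`. -/
theorem contracts_torusGen (m : ℕ) [NeZero m] : Contracts (torusGen m) (699 / 700) := by
  intro f hf
  have h1 := sum_norm_sq_permAvg_le (torusGen m) (i₀ := 0) rfl f
  have h2 := spectral_gap f hf
  simp only [Fin.sum_univ_five] at h1
  have h3 : 0 ≤ ∑ v, ‖f (torusGen m 0 v) - f v‖ ^ 2 := by positivity
  change _ ≤ 14 * (∑ v, ‖f (torusGen m 1 v) - f v‖ ^ 2 + ∑ v, ‖f (torusGen m 2 v) - f v‖ ^ 2 +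
    ∑ v, ‖f (torusGen m 3 v) - f v‖ ^ 2 + ∑ v, ‖f (torusGen m 4 v) - f v‖ ^ 2) at h2
  norm_num at h1
  linarith

theorem sum_permAvg {k : ℕ} (hk : k ≠ 0) (σ : Fin k → Equiv.Perm V) (f : V → ℂ) :
    ∑ v, permAvg σ f v = ∑ v, f v := by
  have hk' : (k : ℂ) ≠ 0 := by exact_mod_cast hk
  simp_rw [permAvg, ← Finset.mul_sum]
  rw [Finset.sum_comm]
  simp_rw [Equiv.sum_comp]
  simp [hk']

/-- Composing the permutations amplifies the contraction. -/
theorem Contracts.exists_pow {k : ℕ} (hk : k ≠ 0) {σ : Fin k → Equiv.Perm V} {c : ℝ} (hc : 0 ≤ c)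
    (h : Contracts σ c) (t : ℕ) : ∃ τ : Fin (k ^ t) → Equiv.Perm V, Contracts τ (c ^ t) := by
  induction t with
  | zero => exact ⟨fun _ => 1, fun f _ => by
      simp only [permAvg, Equiv.Perm.coe_one, id_eq]
      norm_num⟩
  | succ t ih =>
    obtain ⟨τ, hτ⟩ := ih
    rw [pow_succ k]
    refine ⟨fun i => σ (finProdFinEquiv.symm i).2 * τ (finProdFinEquiv.symm i).1,
      fun f hf => ?_⟩
    have hcomp : permAvg (fun i : Fin (k ^ t * k) => σ (finProdFinEquiv.symm i).2 *
        τ (finProdFinEquiv.symm i).1) f = permAvg τ (permAvg σ f) := by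
      funext v
      simp only [permAvg, Equiv.Perm.coe_mul, Function.comp_apply]
      rw [Equiv.sum_comp finProdFinEquiv.symm (fun q : Fin (k ^ t) × Fin k => f (σ q.2 (τ q.1 v))),
        Fintype.sum_prod_type, ← Finset.mul_sum, ← mul_assoc]
      push_cast
      rw [mul_inv]
    rw [hcomp]
    calc _ ≤ c ^ t * ∑ v, ‖permAvg σ f v‖ ^ 2 := hτ _ (by rw [sum_permAvg hk, hf])
      _ ≤ c ^ t * (c * ∑ v, ‖f v‖ ^ 2) := mul_le_mul_of_nonneg_left (h f hf) (pow_nonneg hc t)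
      _ = _ := by ring

/-- On all functions, a contracting average is close to the mean. -/
theorem Contracts.sum_norm_sq_sub_mean_le {k : ℕ} (hk : k ≠ 0) [Nonempty V]
    {σ : Fin k → Equiv.Perm V} {c : ℝ} (hc : 0 ≤ c) (h : Contracts σ c) (f : V → ℂ) :
    ∑ v, ‖permAvg σ f v - (Fintype.card V : ℂ)⁻¹ * ∑ w, f w‖ ^ 2 ≤ c * ∑ v, ‖f v‖ ^ 2 := by
  have hk' : (k : ℂ) ≠ 0 := by exact_mod_cast hk
  have hV : (Fintype.card V : ℂ) ≠ 0 := by exact_mod_cast Fintype.card_ne_zero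
  set μ : ℂ := (Fintype.card V : ℂ)⁻¹ * ∑ w, f w with hμ
  have hsum : ∑ w, f w = Fintype.card V * μ := by rw [hμ, mul_inv_cancel_left₀ hV]
  have h1 : ∀ v, permAvg σ f v - μ = permAvg σ (fun w => f w - μ) v := by
    intro v
    simp [permAvg, mul_sub, hk']
  simp_rw [h1]
  refine (h _ (by simp [hsum])).trans (mul_le_mul_of_nonneg_left ?_ hc)
  -- Subtracting the mean is an orthogonal projection, hence does not increase the norm.
  have h2 : ∀ v, ‖f v - μ‖ ^ 2 = ‖f v‖ ^ 2 + ‖μ‖ ^ 2 - 2 * (f v * (starRingEnd ℂ) μ).re := by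
    intro v
    rw [Complex.sq_norm, Complex.normSq_sub, Complex.sq_norm, Complex.sq_norm]
  simp_rw [h2, Finset.sum_sub_distrib, Finset.sum_add_distrib, ← Finset.mul_sum,
    ← Complex.re_sum, ← Finset.sum_mul, hsum, mul_assoc, Complex.mul_conj']
  have h3 : ((Fintype.card V : ℂ) * (‖μ‖ : ℂ) ^ 2).re = Fintype.card V * ‖μ‖ ^ 2 := by
    rw [← Complex.ofReal_pow, ← Complex.ofReal_natCast, ← Complex.ofReal_mul, Complex.ofReal_re]
  rw [h3]
  simp only [Finset.sum_const, Finset.card_univ, nsmul_eq_mul]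
  have : 0 ≤ (Fintype.card V : ℝ) * ‖μ‖ ^ 2 := by positivity
  linarith

end Averages

/-! ### Sparse approximation of the projections onto constants -/

/-- A set has at most `K` elements if each of them is determined by one of `K` labels. -/
theorem encard_le_of_forall_exists {α : Type*} {K : ℕ} {S : Set α} (R : Fin K → α → Prop)
    (huniq : ∀ a x y, R a x → R a y → x = y) (hS : ∀ x ∈ S, ∃ a, R a x) : S.encard ≤ K := by
  choose g hg using hS
  have hinj : Function.Injective fun x : S => g x.1 x.2 := fun x y h =>
    Subtype.ext (huniq _ _ _ (hg x.1 x.2) (by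
      have : g x.1 x.2 = g y.1 y.2 := h
      rw [this]
      exact hg y.1 y.2))
  calc S.encard = ENat.card S := rfl
    _ ≤ ENat.card (Fin K) := ENat.card_le_card_of_injective hinj
    _ = K := by simp

/-- The entries of the operator of averaging over permutations of `V`, restricted to the positions
in the image of `e` and scaled by `r`. -/
noncomputable def compressedAvg {V : Type*} [DecidableEq V] {n K : ℕ} (r : ℂ)
    (τ : Fin K → Equiv.Perm V) (e : Fin n ↪ V) : Matrix (Fin n) (Fin n) ℂ :=
  Matrix.of fun i j => r * ((K : ℂ)⁻¹ * ∑ a, if τ a (e i) = e j then 1 else 0)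

theorem exists_of_compressedAvg_ne_zero {V : Type*} [DecidableEq V] {n K : ℕ} {r : ℂ}
    {τ : Fin K → Equiv.Perm V} {e : Fin n ↪ V} {i j : Fin n}
    (h : compressedAvg r τ e i j ≠ 0) : ∃ a, τ a (e i) = e j := by
  by_contra! hne
  exact h (by simp [compressedAvg, hne])

theorem compressedAvg_mulVec {V : Type*} [DecidableEq V] {n K : ℕ} (r : ℂ)
    (τ : Fin K → Equiv.Perm V) (e : Fin n ↪ V) (x : Fin n → ℂ) (i : Fin n) :
    (compressedAvg r τ e).mulVec x i = r * permAvg τ (Function.extend e x 0) (e i) := by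
  have h : ∀ v : V, ∑ j, (if v = e j then 1 else 0) * x j = Function.extend e x 0 v := by
    intro v
    by_cases hv : ∃ j, e j = v
    · obtain ⟨j, rfl⟩ := hv
      rw [e.injective.extend_apply]
      simp
    · rw [Function.extend_apply' _ _ _ hv]
      exact Finset.sum_eq_zero fun j _ => by
        rw [if_neg fun h => hv ⟨j, h.symm⟩, zero_mul]
  simp only [Matrix.mulVec, dotProduct, compressedAvg, Matrix.of_apply, permAvg, ← h, mul_assoc,
    ← Finset.mul_sum, Finset.sum_mul]
  rw [Finset.sum_comm]

/-- On vectors extended by zero, the mean over `V` scaled by `card V / (n + 1)` is the mean over the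
`n + 1` positions, so compressing and rescaling an average close to the mean gives a matrix close
to `blockProj n`. -/
theorem norm_compressedAvg_sub_blockProj_le {V : Type*} [Fintype V] [DecidableEq V] {n K : ℕ}
    (hK : K ≠ 0) {τ : Fin K → Equiv.Perm V} {c : ℝ} (hc : 0 ≤ c) (hτ : Contracts τ c)
    (e : Fin (n + 1) ↪ V) :
    ‖Matrix.toEuclideanCLM (n := Fin (n + 1)) (𝕜 := ℂ)
      (compressedAvg ((Fintype.card V : ℂ) / (n + 1)) τ e) - blockProj n‖ ≤
      (Fintype.card V / (n + 1)) * √c := by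
  have hV : Nonempty V := ⟨e 0⟩
  have hV' : (Fintype.card V : ℂ) ≠ 0 := by exact_mod_cast Fintype.card_ne_zero
  have hn : ((n : ℂ) + 1) ≠ 0 := by exact_mod_cast Nat.succ_ne_zero n
  set r : ℝ := Fintype.card V / (n + 1) with hr
  have hr0 : 0 ≤ r := by positivity
  refine ContinuousLinearMap.opNorm_le_bound _ (by positivity) fun x => ?_
  set f : V → ℂ := Function.extend e x 0 with hf
  have hfe : ∀ i, f (e i) = x i := fun i => e.injective.extend_apply _ _ _
  have hf0 : ∀ v, v ∉ Set.range e → f v = 0 := fun v hv => Function.extend_apply' _ _ _ hv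
  have hfsum : ∑ v, f v = ∑ i, x i :=
    (Fintype.sum_of_injective e e.injective _ _ hf0 fun i => (hfe i).symm).symm
  have hfnorm : ∑ v, ‖f v‖ ^ 2 = ‖x‖ ^ 2 := by
    rw [EuclideanSpace.norm_sq_eq]
    exact (Fintype.sum_of_injective e e.injective _ _ (fun v hv => by simp [hf0 v hv])
      fun i => by rw [hfe]).symm
  have hcoord : ∀ i, (Matrix.toEuclideanCLM (n := Fin (n + 1)) (𝕜 := ℂ)
      (compressedAvg ((Fintype.card V : ℂ) / (n + 1)) τ e) x - blockProj n x) i =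
      (r : ℂ) * (permAvg τ f (e i) - (Fintype.card V : ℂ)⁻¹ * ∑ w, f w) := by
    intro i
    rw [PiLp.sub_apply, blockProj, Matrix.ofLp_toEuclideanCLM, Matrix.ofLp_toEuclideanCLM,
      compressedAvg_mulVec, hfsum]
    simp only [Matrix.mulVec, dotProduct, Matrix.of_apply, ← Finset.mul_sum]
    rw [mul_sub, hr]
    push_cast
    congr 1
    field_simp
  rw [sub_apply, ← sq_le_sq₀ (norm_nonneg _) (by positivity),
    EuclideanSpace.norm_sq_eq]
  simp_rw [hcoord, norm_mul, mul_pow, Complex.norm_real, Real.norm_of_nonneg hr0]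
  rw [← Finset.mul_sum, Real.sq_sqrt hc, mul_assoc, ← hfnorm]
  refine mul_le_mul_of_nonneg_left ?_ (by positivity)
  refine le_trans ?_ (hτ.sum_norm_sq_sub_mean_le hK hc f)
  rw [← Finset.sum_map Finset.univ e
    (fun v => ‖permAvg τ f v - (Fintype.card V : ℂ)⁻¹ * ∑ w, f w‖ ^ 2)]
  exact Finset.sum_le_sum_of_subset_of_nonneg (Finset.subset_univ _) fun _ _ _ => by positivity

/-- The projections onto constants are approximated, uniformly in the size, by matrices with a
bounded number of nonzero entries in each row and column. -/
theorem exists_sparse_approx_blockProj {ε : ℝ} (hε : 0 < ε) :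
    ∃ K : ℕ, ∀ n : ℕ, ∃ A : Matrix (Fin (n + 1)) (Fin (n + 1)) ℂ,
      (∀ i, {j | A i j ≠ 0}.encard ≤ K) ∧ (∀ j, {i | A i j ≠ 0}.encard ≤ K) ∧
      ‖Matrix.toEuclideanCLM (n := Fin (n + 1)) (𝕜 := ℂ) A - blockProj n‖ ≤ ε := by
  obtain ⟨t, ht⟩ := exists_pow_lt_of_lt_one (show 0 < (ε / 4) ^ 2 by positivity)
    (show (699 / 700 : ℝ) < 1 by norm_num)
  refine ⟨5 ^ t, fun n => ?_⟩
  -- A square between the size of the block and four times this size.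
  set m := Nat.sqrt n + 1 with hm
  have hcard : Fintype.card (ZMod m × ZMod m) = m * m := by simp [ZMod.card]
  have hm1 : n + 1 ≤ m * m := Nat.lt_succ_sqrt n
  have hm2 : m * m ≤ 4 * (n + 1) := by
    have h1 := Nat.sqrt_le n
    have h2 := Nat.sqrt_le_self n
    rw [hm]
    nlinarith
  obtain ⟨τ, hτ⟩ := (contracts_torusGen m).exists_pow (by norm_num) (by norm_num) t
  obtain ⟨e⟩ : Nonempty (Fin (n + 1) ↪ ZMod m × ZMod m) :=
    Function.Embedding.nonempty_of_card_le (by rw [hcard, Fintype.card_fin]; exact hm1)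
  refine ⟨compressedAvg ((Fintype.card (ZMod m × ZMod m) : ℂ) / (n + 1)) τ e, fun i => ?_,
    fun j => ?_, ?_⟩
  · exact encard_le_of_forall_exists (fun a j => τ a (e i) = e j)
      (fun a x y hx hy => e.injective (hx.symm.trans hy))
      fun j hj => exists_of_compressedAvg_ne_zero hj
  · exact encard_le_of_forall_exists (fun a i => τ a (e i) = e j)
      (fun a x y hx hy => e.injective ((τ a).injective (hx.trans hy.symm)))
      fun i hi => exists_of_compressedAvg_ne_zero hi
  · refine (norm_compressedAvg_sub_blockProj_le (by positivity) (by positivity) hτ e).trans ?_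
    have h1 : (Fintype.card (ZMod m × ZMod m) : ℝ) / (n + 1) ≤ 4 := by
      rw [div_le_iff₀ (by positivity), hcard]
      exact_mod_cast hm2
    have h2 : √((699 / 700 : ℝ) ^ t) ≤ ε / 4 := Real.sqrt_le_iff.2 ⟨by positivity, ht.le⟩
    calc _ ≤ 4 * (ε / 4) := mul_le_mul h1 h2 (by positivity) (by norm_num)
      _ = ε := by ring

theorem inner_blockBasis (i : BlockIndex) (x : BlockSpace) :
    inner ℂ (blockBasis i) x = x i.1 i.2 := by
  rw [blockBasis_apply, inner_blockVec]

/-- A direct sum of operators is block diagonal: its nonzero matrix entries are entries of the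
blocks. -/
theorem opMatrix_mapCLM {C : ℝ} (hC : 0 ≤ C) (A : ∀ n, Matrix (Fin (n + 1)) (Fin (n + 1)) ℂ)
    (hA : ∀ n, ‖Matrix.toEuclideanCLM (n := Fin (n + 1)) (𝕜 := ℂ) (A n)‖ ≤ C) {i j : BlockIndex}
    (h : opMatrix blockBasis (lp.mapCLM 2
      (fun n => Matrix.toEuclideanCLM (n := Fin (n + 1)) (𝕜 := ℂ) (A n)) hC hA) i j ≠ 0) :
    ∃ h : j.1 = i.1, A i.1 i.2 (h ▸ j.2) ≠ 0 := by
  obtain ⟨n, i⟩ := i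
  obtain ⟨k, j⟩ := j
  rw [opMatrix, inner_blockBasis, lp.mapCLM_apply_coe, blockBasis_apply, blockVec] at h
  by_cases hkn : k = n
  · subst hkn
    refine ⟨rfl, ?_⟩
    rw [lp.single_apply_self] at h
    simpa [Matrix.ofLp_toEuclideanCLM] using h
  · rw [lp.single_apply_ne _ _ _ (Ne.symm hkn)] at h
    simp at h

/-! ### The projection and the isometry -/

theorem sumProj_mem_Bf : sumProj ∈ Bf blockBasis := by
  rw [Bf, Metric.mem_closure_iff]
  intro ε hε
  obtain ⟨K, hK⟩ := exists_sparse_approx_blockProj (half_pos hε)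
  choose A hrow hcol hnorm using hK
  have hC : (0 : ℝ) ≤ ε / 2 + 1 := by positivity
  have hA : ∀ n, ‖Matrix.toEuclideanCLM (n := Fin (n + 1)) (𝕜 := ℂ) (A n)‖ ≤ ε / 2 + 1 := fun n =>
    (norm_le_norm_sub_add _ (blockProj n)).trans (add_le_add (hnorm n) (norm_blockProj_le n))
  refine ⟨lp.mapCLM 2 (fun n => Matrix.toEuclideanCLM (n := Fin (n + 1)) (𝕜 := ℂ) (A n)) hC hA,
    Set.mem_iUnion.2 ⟨K, fun i => ?_, fun j => ?_⟩, ?_⟩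
  · refine le_trans (Set.encard_le_encard (t := Sigma.mk i.1 '' {j | A i.1 i.2 j ≠ 0}) ?_)
      ((Set.encard_image_le _ _).trans (hrow i.1 i.2))
    rintro ⟨k, j⟩ hj
    obtain ⟨h, hj⟩ := opMatrix_mapCLM hC A hA hj
    obtain ⟨n, i⟩ := i
    obtain rfl : k = n := h
    exact ⟨j, hj, rfl⟩
  · refine le_trans (Set.encard_le_encard (t := Sigma.mk j.1 '' {i | A j.1 i j.2 ≠ 0}) ?_)
      ((Set.encard_image_le _ _).trans (hcol j.1 j.2))
    rintro ⟨k, i⟩ hi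
    obtain ⟨h, hi⟩ := opMatrix_mapCLM hC A hA hi
    obtain ⟨n, j⟩ := j
    obtain rfl : n = k := h
    exact ⟨i, hi, rfl⟩
  · have hsub : sumProj - lp.mapCLM 2
        (fun n => Matrix.toEuclideanCLM (n := Fin (n + 1)) (𝕜 := ℂ) (A n)) hC hA =
        lp.mapCLM 2 (fun n => blockProj n - Matrix.toEuclideanCLM (n := Fin (n + 1)) (𝕜 := ℂ) (A n))
          (half_pos hε).le (fun n => by rw [norm_sub_rev]; exact hnorm n) := by
      ext x n i
      simp [sumProj]
    rw [dist_eq_norm, hsub]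
    exact (lp.norm_mapCLM_le _ _ _ _).trans_lt (half_lt_self hε)

theorem constVec_apply (k : ℕ) (i : BlockIndex) :
    constVec k i.1 i.2 = if i.1 = k then (((√((k : ℝ) + 1))⁻¹ : ℝ) : ℂ) else 0 := by
  obtain ⟨n, i⟩ := i
  rw [constVec]
  by_cases h : n = k
  · subst h
    rw [lp.single_apply_self]
    simp
  · rw [lp.single_apply_ne _ _ _ h]
    simp [h]

theorem sumProj_blockBasis (i : BlockIndex) :
    sumProj (blockBasis i) = (((√((i.1 : ℝ) + 1))⁻¹ : ℝ) : ℂ) • constVec i.1 := by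
  have hsq : (((√((i.1 : ℝ) + 1))⁻¹ : ℝ) : ℂ) * (((√((i.1 : ℝ) + 1))⁻¹ : ℝ) : ℂ) =
      1 / ((i.1 : ℂ) + 1) := by
    rw [← Complex.ofReal_mul, ← mul_inv, Real.mul_self_sqrt (by positivity)]
    push_cast
    rw [one_div]
  ext n j
  have h := constVec_apply i.1 ⟨n, j⟩
  simp only at h
  rw [lp.coeFn_smul, Pi.smul_apply, PiLp.smul_apply, h, sumProj, lp.mapCLM_apply_coe,
    blockBasis_apply, blockVec]
  by_cases hn : n = i.1
  · obtain ⟨k, i⟩ := i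
    obtain rfl : n = k := hn
    rw [lp.single_apply_self, blockProj, Matrix.ofLp_toEuclideanCLM, if_pos rfl, smul_eq_mul, hsq]
    simp
  · rw [lp.single_apply_ne _ _ _ hn, if_neg hn]
    simp

theorem adjoint_isomOp_blockBasis {i j : BlockIndex} (h : position j = i.1) :
    ContinuousLinearMap.adjoint isomOp (blockBasis i) =
      (((√((i.1 : ℝ) + 1))⁻¹ : ℝ) : ℂ) • blockBasis j := by
  refine blockBasis.repr.injective (lp.ext (funext fun l => ?_))
  rw [HilbertBasis.repr_apply_apply, HilbertBasis.repr_apply_apply,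
    ContinuousLinearMap.adjoint_inner_right, isomOp_apply, inner_smul_right,
    orthonormal_iff_ite.1 blockBasis.orthonormal, ← inner_conj_symm, inner_blockBasis,
    constVec_apply]
  by_cases hl : l = j
  · subst hl
    simp [h]
  · have : i.1 ≠ position l := fun h' => hl (position_bijective.injective (h'.symm.trans h.symm))
    simp [hl, this]

theorem sumProj_eq_comp_adjoint :
    sumProj = isomOp.comp (ContinuousLinearMap.adjoint isomOp) := by
  refine ContinuousLinearMap.ext_on
    (Submodule.dense_iff_topologicalClosure_eq_top.2 blockBasis.dense_span) ?_
  rintro _ ⟨i, rfl⟩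
  obtain ⟨j, hj⟩ := position_bijective.surjective i.1
  rw [ContinuousLinearMap.comp_apply, adjoint_isomOp_blockBasis hj, map_smul, isomOp_apply, hj,
    sumProj_blockBasis]

/-- The column of `v` in position `2k + 1` consists of `2k + 2` equal entries. An operator with at
most `k` nonzero entries in this column misses more than half of its norm. -/
theorem isomOp_notMem_Bf : isomOp ∉ Bf blockBasis := by
  intro hmem
  rw [Bf, Metric.mem_closure_iff] at hmem
  obtain ⟨a, ha, hdist⟩ := hmem (1 / 2) (by norm_num)
  obtain ⟨k, hk⟩ := Set.mem_iUnion.1 ha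
  obtain ⟨j, hj⟩ := position_bijective.surjective (2 * k + 1)
  have hcol := hk.2 j
  set d : BlockSpace := (isomOp - a) (blockBasis j) with hd
  have hdn : ‖d‖ ≤ 1 / 2 := by
    refine ((isomOp - a).le_opNorm _).trans ?_
    rw [blockBasis.orthonormal.1 j, mul_one, ← dist_eq_norm]
    exact hdist.le
  classical
  set Z : Finset (Fin (2 * k + 1 + 1)) :=
    {i | opMatrix blockBasis a ⟨2 * k + 1, i⟩ j ≠ 0} with hZ
  have hZcard : Z.card ≤ k := by
    have h1 : (Sigma.mk (2 * k + 1) '' (Z : Set (Fin (2 * k + 1 + 1))) : Set BlockIndex).encard ≤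
        k := by
      refine le_trans (Set.encard_le_encard ?_) hcol
      rintro _ ⟨i, hi, rfl⟩
      simpa [hZ] using hi
    rw [Function.Injective.encard_image sigma_mk_injective, Set.encard_coe_eq_coe_finsetCard] at h1
    exact_mod_cast h1
  have hblock : ‖d (2 * k + 1)‖ ^ 2 ≤ (1 / 2) ^ 2 :=
    pow_le_pow_left₀ (norm_nonneg _)
      ((lp.norm_apply_le_norm (by norm_num) d (2 * k + 1)).trans hdn) 2
  rw [EuclideanSpace.norm_sq_eq] at hblock
  have hentry : ∀ i ∈ Zᶜ, ‖d (2 * k + 1) i‖ ^ 2 = (2 * (k : ℝ) + 2)⁻¹ := by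
    intro i hi
    have h0 : a (blockBasis j) (2 * k + 1) i = 0 := by
      simpa [hZ, opMatrix, inner_blockBasis] using hi
    have h1 := constVec_apply (2 * k + 1) ⟨2 * k + 1, i⟩
    simp only [if_true] at h1
    rw [hd, sub_apply, isomOp_apply, hj, lp.coeFn_sub, Pi.sub_apply, PiLp.sub_apply, h0, sub_zero,
      h1, Complex.norm_real, Real.norm_of_nonneg (by positivity), inv_pow,
      Real.sq_sqrt (by positivity)]
    push_cast
    ring
  have hlow : ((Zᶜ).card : ℝ) * (2 * (k : ℝ) + 2)⁻¹ ≤ (1 / 2) ^ 2 := by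
    refine le_trans (le_of_eq ?_) ((Finset.sum_le_sum_of_subset_of_nonneg (Finset.subset_univ Zᶜ)
      fun _ _ _ => by positivity).trans hblock)
    rw [Finset.sum_congr rfl hentry, Finset.sum_const, nsmul_eq_mul]
  have hcompl : (k : ℝ) + 2 ≤ (Zᶜ).card := by
    rw [Finset.card_compl, Fintype.card_fin]
    exact_mod_cast (by omega : k + 2 ≤ 2 * k + 1 + 1 - Z.card)
  rw [← div_eq_mul_inv, div_le_iff₀ (by positivity)] at hlow
  have : (0 : ℝ) ≤ k := by positivity
  linarith

end MatrixFinite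

theorem mainTheorem4 :
    (∀ n : ℕ, blockProj n = (constLine n).starProjection) ∧
    sumProj ∈ Bf blockBasis ∧
    Isometry isomOp ∧
    (∀ i : BlockIndex, isomOp (blockBasis i) = constVec (position i)) ∧
    sumProj = isomOp.comp (ContinuousLinearMap.adjoint isomOp) ∧
    isomOp ∉ Bf blockBasis :=
  ⟨blockProj_eq, sumProj_mem_Bf, isom.isometry, isomOp_apply, sumProj_eq_comp_adjoint,
    isomOp_notMem_Bf⟩
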